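/- Let $E$ be a finite group with a faithful irreducible unitary representation $\rho$ on a finite-dimensional complex Hilbert space $H$ of dimension $|E:Z(E)|^{1/2}$, and let $\phi(g)=\operatorname{Tr}\rho(g)$. Let $N$ be a normal subgroup of $E$ and $\chi$ an irreducible complex character of $N$ with $(\chi,\phi|_N)_N=|N|^{-1}\sum_{n\in N}\chi(n)\phi(n^{-1})>0$. Let $C\subseteq H$ be the Clifford code with data $(E,\rho,N,\chi)$, that is, the image of $$P=\frac{\chi(1)}{|N|}\sum_{n\in N}\chi(n^{-1})\rho(n),$$ and let $I_E(\chi)=\{g\in E\mid \chi(gxg^{-1})=\chi(x)\text{ for all }x\in N\}$ be the inertia group of $\chi$. Suppose that $I_E(\chi)=LN$ for some subgroup $L$ of $E$ with $[L,N]=1$. Then $C$ is an operator quantum error-correcting code $C=A\otimes B$: there are finite-dimensional Hilbert spaces $A$ and $B$ and an isometric isomorphism $A\otimes B\cong C$ such that (i) $\dim A=|Z(E)\cap N|\,|E:Z(E)|^{1/2}\,\chi(1)/|N|$; (ii) $\dim B=\chi(1)$; (iii) $A$ is an irreducible $\mathbf{C}L$-module, through which $L$ acts on $C$, that is, $\rho(\ell)(a\otimes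 b)=(\ell a)\otimes b$ for all $\ell\in L$, $a\in A$, $b\in B$; (iv) if $\chi_A\in\operatorname{Irr}(L)$ is the character of this module and $Z(\chi_A)=\{\ell\in L\mid \chi_A(1)=|\chi_A(\ell)|\}$, then an error $e\in E$ is detectable by the subsystem $A$ if and only if $e\in E-(I_E(\chi)-Z(\chi_A)N)$. Here $e$ is called detectable by the subsystem $A$ if there is a linear operator $T$ on $B$ such that, with $P_C$ the orthogonal projector of $H$ onto $C$, $P_C\,\rho(e)(a\otimes b)=a\otimes Tb$ for all $a\in A$, $b\in B$. -/

import Mathlib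

open scoped TensorProduct Pointwise ComplexOrder

noncomputable section

namespace CliffordCode

universe u v

/-- A complex-valued function on `G` is an irreducible character if it is the character of an
irreducible finite-dimensional complex representation of `G`. -/
def IsIrrChar {G : Type v} [Group G] (χ : G → ℂ) : Prop :=
  ∃ (n : ℕ) (τ : Representation ℂ G (Fin n → ℂ)), τ.IsIrreducible ∧ τ.character = χ

/-- The scalar product `(χ, ψ)_G = |G|⁻¹ ∑ χ(g) ψ(g⁻¹)`. -/
def charProd {G : Type v} [Group G] [Fintype G] (χ ψ : G → ℂ) : ℂ :=
  (Fintype.card G : ℂ)⁻¹ * ∑ g : G, χ g * ψ g⁻¹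

/-- The quasikernel `Z(χ) = {g | χ(1) = |χ(g)|}`. -/
def quasikernel {G : Type v} [Group G] (χ : G → ℂ) : Set G :=
  {g | χ 1 = (‖χ g‖ : ℂ)}

/-- The inertia group `I_E(χ) = {g | χ(g x g⁻¹) = χ(x) for all x ∈ N}` of a function `χ` on a
normal subgroup `N` of `E`. -/
def inertiaGroup {E : Type v} [Group E] (N : Subgroup E) [N.Normal] (χ : N → ℂ) : Subgroup E where
  carrier := {g | ∀ x : N, χ (MulAut.conjNormal g x) = χ x}
  one_mem' := fun x => by simp
  mul_mem' := fun {a b} ha hb x => by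
    rw [map_mul, MulAut.mul_apply, ha, hb]
  inv_mem' := fun {a} ha x => by
    have h := ha (MulAut.conjNormal a⁻¹ x)
    rw [← MulAut.mul_apply, ← map_mul, mul_inv_cancel, map_one, MulAut.one_apply] at h
    exact h.symm

section

variable {E : Type v} [Group E]
  {H : Type u} [NormedAddCommGroup H] [InnerProductSpace ℂ H] [FiniteDimensional ℂ H]

/-- `ρ` is a faithful irreducible unitary representation of `E` of degree `|E : Z(E)|^{1/2}`, so
that (`E` being finite) `E` is an abstract error group. -/
structure IsErrorRep (ρ : Representation ℂ E H) : Prop where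
  unitary : ∀ (g : E) (x y : H), inner ℂ (ρ g x) (ρ g y) = inner ℂ x y
  faithful : Function.Injective ρ
  irreducible : ρ.IsIrreducible
  degree : (Module.finrank ℂ H : ℝ) = Real.sqrt ((Subgroup.center E).index : ℝ)

/-- `(E, ρ, N, χ)` are the data of a Clifford code. -/
structure IsData (ρ : Representation ℂ E H) (N : Subgroup E) [Fintype N] (χ : N → ℂ) : Prop where
  errorRep : IsErrorRep ρ
  normal : N.Normal
  irrChar : IsIrrChar χ
  pos : 0 < charProd χ (fun n : N => ρ.character n)

/-- The operator `P = (χ(1) / |N|) ∑_{n ∈ N} χ(n⁻¹) ρ(n)`. -/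
def projector (ρ : Representation ℂ E H) (N : Subgroup E) [Fintype N] (χ : N → ℂ) : H →ₗ[ℂ] H :=
  (χ 1 / (Fintype.card N : ℂ)) • ∑ n : N, χ n⁻¹ • ρ (n : E)

/-- The Clifford code with data `(E, ρ, N, χ)`: the image of `P`. -/
def code (ρ : Representation ℂ E H) (N : Subgroup E) [Fintype N] (χ : N → ℂ) : Submodule ℂ H :=
  LinearMap.range (projector ρ N χ)

end

/-- An operator quantum error-correcting code structure on a subspace `C` of a finite-dimensional
Hilbert space: an identification `C = A ⊗ B` (as Hilbert spaces) with a subsystem `A` and a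
co-subsystem `B`. -/
structure Subsystem {H : Type u} [NormedAddCommGroup H] [InnerProductSpace ℂ H]
    (C : Submodule ℂ H) where
  A : Type u
  B : Type u
  [normedA : NormedAddCommGroup A]
  [normedB : NormedAddCommGroup B]
  [innerA : InnerProductSpace ℂ A]
  [innerB : InnerProductSpace ℂ B]
  [finA : FiniteDimensional ℂ A]
  [finB : FiniteDimensional ℂ B]
  iso : (A ⊗[ℂ] B) ≃ₗᵢ[ℂ] C

attribute [instance] Subsystem.normedA Subsystem.normedB Subsystem.innerA Subsystem.innerB
  Subsystem.finA Subsystem.finB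

/-- The error operator `X` is detectable by the subsystem `A` of `C = A ⊗ B`: with `P` the
orthogonal projector onto `C`, the compression `P X P` acts on `C = A ⊗ B` as `1 ⊗ T` for some
linear operator `T` on `B` (a scalar on `A`, arbitrary on `B`). -/
def Subsystem.Detects {H : Type u} [NormedAddCommGroup H] [InnerProductSpace ℂ H]
    [FiniteDimensional ℂ H] {C : Submodule ℂ H} (D : Subsystem C) (X : H →ₗ[ℂ] H) : Prop :=
  ∃ T : D.B →ₗ[ℂ] D.B, ∀ (a : D.A) (b : D.B),
    C.starProjection (X (D.iso (a ⊗ₜ[ℂ] b) : H)) = (D.iso (a ⊗ₜ[ℂ] T b) : H)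

end CliffordCode

end

/-! Let `τ` be the representation of `N` affording the character. The code is the `τ`-isotypic
component of the restriction of `ρ` to `N`, and evaluation identifies it with `Hom_N(τ, H) ⊗ τ`. By
Schur's lemma all values `⟨S v, T w⟩` of intertwiners are multiples of one inner product on `τ`, so
this identification is unitary for suitable inner products on the factors
(`exists_tensor_decomposition`). Operators commuting with `N`, in particular those of `L`, act on
the first factor `A` alone, while `N` acts on the second factor `B` alone.

The dimension of `A` is a multiplicity. It is computed from the fact that the character of `ρ`
vanishes off the centre, because the degree is as large as possible
(`IsErrorRep.character_eq_zero`).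

Errors outside the inertia group send the code into its kernel under the projector, since
conjugation moves `τ` to an inequivalent representation. Errors `l * m` in the inertia group `LN`
act as `σ l ⊗ τ m`. This has the form `1 ⊗ T` exactly when `σ l` is a scalar, that is, when `l` lies
in the quasikernel. The same dichotomy, together with irreducibility of `ρ`, forces `A` to be
irreducible under `L`. -/

open scoped TensorProduct Pointwise ComplexOrder

noncomputable section

namespace CliffordCode

open Representation Module

/-! ### Schur's lemma and character sums for a finite group -/

section Finite

variable {G : Type*} [Group G] [Fintype G] {V : Type*} [AddCommGroup V] [Module ℂ V]
  {W : Type*} [AddCommGroup W] [Module ℂ W]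

/-- The sum `∑ g, σ(g) f τ(g⁻¹)`, an intertwining map. -/
def sumConj (τ : Representation ℂ G V) (σ : Representation ℂ G W) (f : V →ₗ[ℂ] W) :
    IntertwiningMap τ σ :=
  (∑ g : G, σ g ∘ₗ f ∘ₗ τ g⁻¹).intertwiningMap_of_isIntertwiningMap τ σ (fun h v => by
    simp only [LinearMap.sum_apply, LinearMap.comp_apply, map_sum]
    refine Fintype.sum_equiv (Equiv.mulLeft h⁻¹) _ _ (fun g => ?_)
    simp only [Equiv.coe_mulLeft, ← Module.End.mul_apply, ← map_mul]
    simp)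

lemma sumConj_apply (τ : Representation ℂ G V) (σ : Representation ℂ G W) (f : V →ₗ[ℂ] W) (v : V) :
    sumConj τ σ f v = ∑ g : G, σ g (f (τ g⁻¹ v)) := by
  change (∑ g : G, σ g ∘ₗ f ∘ₗ τ g⁻¹) v = _
  simp

lemma trace_eq_sum_coord {ι : Type*} [Fintype ι] (b : Basis ι ℂ V) (f : V →ₗ[ℂ] V) :
    LinearMap.trace ℂ V f = ∑ i, b.coord i (f (b i)) := by
  classical
  rw [LinearMap.trace_eq_matrix_trace ℂ b, Matrix.trace]
  simp [LinearMap.toMatrix_apply]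

/-- Expanding the trace in a basis exhibits a character sum applied to `x` as a sum of values of
intertwiners; this is what bounds the range of the projector. -/
lemma sum_character_smul {ι : Type*} [Fintype ι] (b : Basis ι ℂ V)
    (τ : Representation ℂ G V) (σ : Representation ℂ G W) (x : W) :
    ∑ g : G, τ.character g⁻¹ • σ g x = ∑ i, sumConj τ σ ((b.coord i).smulRight x) (b i) := by
  simp only [sumConj_apply, LinearMap.smulRight_apply, map_smul]
  rw [Finset.sum_comm]
  refine Finset.sum_congr rfl (fun g _ => ?_)
  rw [character, trace_eq_sum_coord b, Finset.sum_smul]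

/-- Schur's lemma. -/
lemma exists_eq_smul_of_commute [FiniteDimensional ℂ V] {G : Type*} [Group G]
    (τ : Representation ℂ G V) (hτ : τ.IsIrreducible) (f : V →ₗ[ℂ] V)
    (hf : ∀ g v, f (τ g v) = τ g (f v)) : ∃ c : ℂ, ∀ v, f v = c • v := by
  have := hτ
  let F : IntertwiningMap τ τ := f.intertwiningMap_of_isIntertwiningMap τ τ hf
  obtain ⟨c, hc⟩ := (IsIrreducible.algebraMap_intertwiningMap_bijective_of_isAlgClosed (ρ := τ)).2 F
  refine ⟨c, fun v => ?_⟩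
  change F v = _
  rw [← hc]
  rfl

lemma nontrivial_of_isIrreducible {G : Type*} [Group G]
    (τ : Representation ℂ G V) (hτ : τ.IsIrreducible) : Nontrivial V := by
  by_contra h
  rw [not_nontrivial_iff_subsingleton] at h
  have := hτ.toNontrivial
  apply not_subsingleton (Subrepresentation τ)
  exact ⟨fun a b => Subrepresentation.toSubmodule_injective (Subsingleton.elim _ _)⟩

/-- A class function defines a central element of the group algebra, which acts as a scalar by
Schur; the trace determines that scalar. -/
lemma sum_smul_apply_of_conj_invariant [FiniteDimensional ℂ V] (τ : Representation ℂ G V)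
    (hτ : τ.IsIrreducible) (f : G → ℂ) (hf : ∀ g h, f (h * g * h⁻¹) = f g) (v : V) :
    ∑ g : G, f g • τ g v = ((∑ g : G, f g * τ.character g) / finrank ℂ V) • v := by
  have := nontrivial_of_isIrreducible τ hτ
  obtain ⟨c, hc⟩ := exists_eq_smul_of_commute τ hτ (∑ g : G, f g • τ g) (fun h v => by
    simp only [LinearMap.sum_apply, LinearMap.smul_apply, map_sum, map_smul]
    refine Fintype.sum_equiv (MulAut.conj h⁻¹).toEquiv _ _ (fun g => ?_)
    have : f (h⁻¹ * g * h) = f g := by simpa using hf g h⁻¹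
    simp only [MulEquiv.toEquiv_eq_coe, MulEquiv.coe_toEquiv, MulAut.conj_apply, inv_inv, this]
    simp only [← Module.End.mul_apply, ← map_mul]
    simp [mul_assoc])
  have h1 : (∑ g : G, f g • τ g) = c • (1 : V →ₗ[ℂ] V) := by ext v; simpa using hc v
  have h2 := congrArg (LinearMap.trace ℂ V) h1
  simp only [map_sum, map_smul, LinearMap.trace_one, smul_eq_mul] at h2
  have h3 : (finrank ℂ V : ℂ) ≠ 0 := by
    exact_mod_cast finrank_pos.ne'
  have h4 : (∑ g : G, f g * τ.character g) = c * finrank ℂ V := h2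
  rw [h4, mul_div_cancel_right₀ _ h3, ← hc]
  simp

lemma sum_character_inv_mul_character [FiniteDimensional ℂ V] (τ : Representation ℂ G V)
    (hτ : τ.IsIrreducible) :
    ∑ g : G, τ.character g⁻¹ * τ.character g = Fintype.card G := by
  have := hτ
  have : Invertible (Nat.card G : ℂ) := invertibleOfNonzero (by simp)
  have h := char_orthonormal τ τ
  rw [if_pos ⟨Representation.Equiv.refl τ⟩, inv_mul_eq_one₀ (by simp)] at h
  simp only [mul_comm (τ.character _⁻¹)]
  rw [← h]; simp

lemma sum_character_inv_smul_apply [FiniteDimensional ℂ V] (τ : Representation ℂ G V)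
    (hτ : τ.IsIrreducible) (v : V) :
    ∑ g : G, τ.character g⁻¹ • τ g v = ((Fintype.card G : ℂ) / finrank ℂ V) • v := by
  rw [sum_smul_apply_of_conj_invariant τ hτ (fun g => τ.character g⁻¹), sum_character_inv_mul_character τ hτ]
  intro g h
  simp only [mul_inv_rev, inv_inv, ← mul_assoc]
  exact τ.char_conj g⁻¹ h

/-- The twist `τ ∘ α` has the same invariant subspaces, hence is irreducible, and its character
differs from that of `τ`; orthogonality of characters makes the scalar zero. -/
lemma sum_character_twist_smul_apply [FiniteDimensional ℂ V] (τ : Representation ℂ G V)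
    (hτ : τ.IsIrreducible) (α : G ≃* G) (hα : ∃ g, τ.character (α g) ≠ τ.character g) (v : V) :
    ∑ g : G, τ.character (α g)⁻¹ • τ g v = 0 := by
  have := hτ
  let τ' : Representation ℂ G V := τ.comp α.toMonoidHom
  have hτ' : τ'.IsIrreducible := by
    refine (OrderIso.isSimpleOrder_iff ?_).1 hτ
    exact
      { toFun := fun S => ⟨S.toSubmodule, fun g _ hv => S.apply_mem_toSubmodule (α g) hv⟩
        invFun := fun S => ⟨S.toSubmodule, fun g v hv => by
          simpa [τ'] using S.apply_mem_toSubmodule (α.symm g) hv⟩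
        left_inv := fun _ => rfl
        right_inv := fun _ => rfl
        map_rel_iff' := Iff.rfl }
  have : Invertible (Nat.card G : ℂ) := invertibleOfNonzero (by simp)
  have hc : τ'.character = fun g => τ.character (α g) := rfl
  have h := char_orthonormal τ τ'
  rw [if_neg, hc] at h
  · rw [sum_smul_apply_of_conj_invariant τ hτ (fun g => τ.character (α g)⁻¹)]
    · have h' := (mul_eq_zero.1 h).resolve_left (by simp)
      rw [Finset.sum_congr rfl (fun g _ => mul_comm (τ.character (α g)⁻¹) (τ.character g))]
      simp only [map_inv] at h'
      rw [h']; simp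
    · intro g h
      simp only [map_mul, map_inv, mul_inv_rev, inv_inv, ← mul_assoc]
      exact τ.char_conj (α g)⁻¹ (α h)
  · rintro ⟨e⟩
    obtain ⟨g, hg⟩ := hα
    exact hg (congrFun (char_iso e) g)

end Finite

/-! ### The isotypic component as a tensor product of Hilbert spaces -/

section Isotypic

variable {G : Type*} [Group G] {V : Type*} [AddCommGroup V] [Module ℂ V] [FiniteDimensional ℂ V]
  {H : Type*} [NormedAddCommGroup H] [InnerProductSpace ℂ H] [FiniteDimensional ℂ H]

/-- The projector `(χ(1) / |G|) ∑ χ(g⁻¹) σ(g)` onto the `χ`-isotypic component of `σ`. -/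
def isoProj [Fintype G] (σ : Representation ℂ G H) (χ : G → ℂ) : H →ₗ[ℂ] H :=
  (χ 1 / (Fintype.card G : ℂ)) • ∑ g : G, χ g⁻¹ • σ g

omit [FiniteDimensional ℂ H] in
lemma isoProj_apply [Fintype G] (σ : Representation ℂ G H) (χ : G → ℂ) (x : H) :
    isoProj σ χ x = (χ 1 / (Fintype.card G : ℂ)) • ∑ g : G, χ g⁻¹ • σ g x := by
  simp [isoProj]

omit [FiniteDimensional ℂ H] in
lemma isoProj_intertwiningMap_apply [Fintype G] (σ : Representation ℂ G H)
    (τ : Representation ℂ G V) (hτ : τ.IsIrreducible) (T : IntertwiningMap τ σ) (v : V) :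
    isoProj σ τ.character (T v) = T v := by
  have := nontrivial_of_isIrreducible τ hτ
  have h3 : (finrank ℂ V : ℂ) ≠ 0 := by exact_mod_cast finrank_pos.ne'
  simp only [isoProj_apply, ← IntertwiningMap.isIntertwining, char_one]
  rw [Finset.sum_congr rfl (fun g _ => (map_smul T _ _).symm), ← map_sum,
    sum_character_inv_smul_apply τ hτ, ← map_smul, smul_smul, div_mul_div_cancel₀ (by simp), div_self h3, one_smul]

-- The range is spanned by values of intertwiners, so a property closed under linear combinations
-- need only be tested on vectors `T v`.
omit [FiniteDimensional ℂ H] in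
lemma range_isoProj_le [Fintype G] (σ : Representation ℂ G H) (τ : Representation ℂ G V)
    (U : Submodule ℂ H) (hU : ∀ (T : IntertwiningMap τ σ) v, T v ∈ U) :
    LinearMap.range (isoProj σ τ.character) ≤ U := by
  rintro _ ⟨x, rfl⟩
  rw [isoProj_apply, sum_character_smul (finBasis ℂ V)]
  exact U.smul_mem _ (U.sum_mem fun i _ => hU _ _)

/-- Two invariant sesquilinear forms on an irreducible representation are proportional. The fixed
injective `T₀` supplies the reference form, and evaluation at `v₀` supplies the constant. -/
lemma inner_intertwiningMap_apply (σ : Representation ℂ G H)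
    (hσ : ∀ (g : G) (x y : H), inner ℂ (σ g x) (σ g y) = inner ℂ x y)
    (τ : Representation ℂ G V) (hτ : τ.IsIrreducible) (T₀ S T : IntertwiningMap τ σ)
    (hT₀ : Function.Injective T₀) (v₀ : V) (hv₀ : ‖T₀ v₀‖ = 1) (v w : V) :
    inner ℂ (S v) (T w) = inner ℂ (S v₀) (T v₀) * inner ℂ (T₀ v) (T₀ w) := by
  let e : V ≃ₗ[ℂ] LinearMap.range T₀.toLinearMap := LinearEquiv.ofInjective T₀.toLinearMap hT₀
  have he (u) : (e u : H) = T₀ u := rfl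
  let S' : LinearMap.range T₀.toLinearMap →ₗ[ℂ] H := S.toLinearMap ∘ₗ e.symm.toLinearMap
  -- `M` represents the form `⟨S v, T w⟩` with respect to the form pulled back by `T₀`; it commutes
  -- with `τ`, hence is a scalar.
  let M : V →ₗ[ℂ] V := e.symm.toLinearMap ∘ₗ S'.adjoint ∘ₗ T.toLinearMap
  have hM (v w : V) : inner ℂ (T₀ v) (T₀ (M w)) = inner ℂ (S v) (T w) := by
    rw [← he, ← he, ← Submodule.coe_inner]
    change inner ℂ (e v) (e (e.symm (S'.adjoint (T w)))) = _
    rw [e.apply_symm_apply, LinearMap.adjoint_inner_right]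
    change inner ℂ (S (e.symm (e v))) _ = _
    rw [e.symm_apply_apply]
  have hσ' (g : G) (x y : H) : inner ℂ x (σ g y) = inner ℂ (σ g⁻¹ x) y := by
    rw [← hσ g (σ g⁻¹ x), ← Module.End.mul_apply, ← map_mul]; simp
  obtain ⟨c, hc⟩ := exists_eq_smul_of_commute τ hτ M (fun g w => by
    apply e.injective
    refine ext_inner_left ℂ (fun y => ?_)
    obtain ⟨x, hx⟩ := e.surjective y
    rw [← hx, Submodule.coe_inner, Submodule.coe_inner, he, he, he,
      hM, IntertwiningMap.isIntertwining, IntertwiningMap.isIntertwining, hσ', hσ',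
      ← IntertwiningMap.isIntertwining, ← IntertwiningMap.isIntertwining, hM])
  have key (v w : V) : inner ℂ (S v) (T w) = c * inner ℂ (T₀ v) (T₀ w) := by
    rw [← hM, hc, map_smul, inner_smul_right]
  rw [key, key v₀ v₀, inner_self_eq_norm_sq_to_K, hv₀]
  simp

/-- A linear map on a tensor product preserving inner products of pure tensors is isometric. -/
def tensorIsometry {A B C : Type*} [NormedAddCommGroup A] [InnerProductSpace ℂ A]
    [NormedAddCommGroup B] [InnerProductSpace ℂ B] [NormedAddCommGroup C] [InnerProductSpace ℂ C]
    (f : A ⊗[ℂ] B →ₗ[ℂ] C) (hf : ∀ (a a' : A) (b b' : B),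
      inner ℂ (f (a ⊗ₜ b)) (f (a' ⊗ₜ b')) = inner ℂ a a' * inner ℂ b b') : A ⊗[ℂ] B →ₗᵢ[ℂ] C :=
  f.isometryOfInner fun x y => by
    induction x with
    | zero => simp
    | add x x' hx hx' => rw [map_add, inner_add_left, inner_add_left, hx, hx']
    | tmul a b =>
      induction y with
      | zero => simp
      | add y y' hy hy' => rw [map_add, inner_add_right, inner_add_right, hy, hy']
      | tmul a' b' => rw [hf, TensorProduct.inner_tmul]

/-- Both factors are realised inside `H`: `A` as the vectors `T v₀` and `B` as the image of `T₀`.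
Their inherited inner products are the ones that make `T v₀ ⊗ T₀ v ↦ T v` isometric. An operator
commuting with `G` acts on intertwiners by composition, hence on `A` by restriction. -/
lemma exists_tensor_decomposition [Fintype G] (σ : Representation ℂ G H)
    (hσ : ∀ (g : G) (x y : H), inner ℂ (σ g x) (σ g y) = inner ℂ x y)
    (τ : Representation ℂ G V) (hτ : τ.IsIrreducible) (hne : ∃ T : IntertwiningMap τ σ, T ≠ 0) :
    ∃ (A B : Submodule ℂ H)
      (iso : (A ⊗[ℂ] B) ≃ₗᵢ[ℂ] LinearMap.range (isoProj σ τ.character)) (e : V ≃ₗ[ℂ] B),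
      finrank ℂ A = finrank ℂ (IntertwiningMap τ σ) ∧
      (∀ g (a : A) v, σ g (iso (a ⊗ₜ[ℂ] e v) : H) = (iso (a ⊗ₜ[ℂ] e (τ g v)) : H)) ∧
      (∀ X : H →ₗ[ℂ] H, (∀ g x, X (σ g x) = σ g (X x)) → ∃ hX : ∀ a ∈ A, X a ∈ A,
        ∀ (a : A) (b : B), X (iso (a ⊗ₜ[ℂ] b) : H) = (iso (⟨X a, hX a a.2⟩ ⊗ₜ[ℂ] b) : H)) := by
  have := hτ
  obtain ⟨T₀, hT₀⟩ := hne
  have hinj : Function.Injective T₀ := (IsIrreducible.injective_or_eq_zero T₀).resolve_right hT₀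
  obtain ⟨v₀, hv₀⟩ : ∃ v₀, ‖T₀ v₀‖ = 1 := by
    have := nontrivial_of_isIrreducible τ hτ
    obtain ⟨v, hv⟩ := exists_ne (0 : V)
    have h : T₀ v ≠ 0 := fun h => hv (hinj (h.trans (map_zero T₀).symm))
    refine ⟨((‖T₀ v‖⁻¹ : ℝ) : ℂ) • v, ?_⟩
    rw [map_smul, norm_smul]
    simp [h]
  have inner_eq (S T : IntertwiningMap τ σ) (v w) :=
    inner_intertwiningMap_apply σ hσ τ hτ T₀ S T hinj v₀ hv₀ v w
  let ev : IntertwiningMap τ σ →ₗ[ℂ] H :=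
    { toFun := fun T => T v₀, map_add' := fun _ _ => rfl, map_smul' := fun _ _ => rfl }
  have hev : Function.Injective ev := by
    rw [injective_iff_map_eq_zero]
    intro T hT
    refine DFunLike.ext _ _ fun v => ?_
    have h := inner_eq T T v v
    change T v₀ = 0 at hT
    rw [hT, inner_zero_left, zero_mul, inner_self_eq_zero] at h
    exact h
  let k : IntertwiningMap τ σ ≃ₗ[ℂ] LinearMap.range ev := LinearEquiv.ofInjective ev hev
  have hk (T) : (k T : H) = T v₀ := rfl
  let e : V ≃ₗ[ℂ] LinearMap.range T₀.toLinearMap := LinearEquiv.ofInjective T₀.toLinearMap hinj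
  have he (u) : (e u : H) = T₀ u := rfl
  let Φ : (LinearMap.range ev) ⊗[ℂ] (LinearMap.range T₀.toLinearMap) →ₗ[ℂ] H :=
    TensorProduct.lift (LinearMap.mk₂ ℂ (fun a b => k.symm a (e.symm b))
      (fun a a' b => by simp) (fun c a b => by simp) (fun a b b' => by simp)
      (fun c a b => by simp))
  have hΦ (T v) : Φ (k T ⊗ₜ e v) = T v := by simp [Φ]
  have hmem (T : IntertwiningMap τ σ) (v) : T v ∈ LinearMap.range (isoProj σ τ.character) :=
    ⟨T v, isoProj_intertwiningMap_apply σ τ hτ T v⟩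
  have hΦmem (x) : Φ x ∈ LinearMap.range (isoProj σ τ.character) := by
    induction x with
    | zero => simp
    | add x x' hx hx' => rw [map_add]; exact add_mem hx hx'
    | tmul a b =>
      obtain ⟨S, rfl⟩ := k.surjective a
      obtain ⟨v, rfl⟩ := e.surjective b
      rw [hΦ]; exact hmem S v
  let Ψ := tensorIsometry (Φ.codRestrict (LinearMap.range (isoProj σ τ.character)) hΦmem)
    (fun a a' b b' => by
      obtain ⟨S, rfl⟩ := k.surjective a
      obtain ⟨T, rfl⟩ := k.surjective a'
      obtain ⟨v, rfl⟩ := e.surjective b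
      obtain ⟨w, rfl⟩ := e.surjective b'
      rw [Submodule.coe_inner]
      change inner ℂ (Φ (k S ⊗ₜ e v)) (Φ (k T ⊗ₜ e w)) = _
      rw [hΦ, hΦ, inner_eq]
      rfl)
  have hΨ : Function.Surjective Ψ := by
    rintro ⟨y, hy⟩
    obtain ⟨x, hx⟩ := range_isoProj_le σ τ (LinearMap.range Φ)
      (fun T v => ⟨k T ⊗ₜ e v, hΦ T v⟩) hy
    exact ⟨x, Subtype.ext hx⟩
  let iso := LinearIsometryEquiv.ofSurjective Ψ hΨ
  have hiso (T v) : (iso (k T ⊗ₜ e v) : H) = T v := hΦ T v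
  refine ⟨_, _, iso, e, k.finrank_eq.symm, fun g a v => ?_, fun X hX => ?_⟩
  · obtain ⟨S, rfl⟩ := k.surjective a
    rw [hiso, hiso, IntertwiningMap.isIntertwining]
  · let XT (T : IntertwiningMap τ σ) : IntertwiningMap τ σ :=
      (X ∘ₗ T.toLinearMap).intertwiningMap_of_isIntertwiningMap τ σ (fun g v => by
        simp [IntertwiningMap.isIntertwining, hX])
    have hXT (T v) : XT T v = X (T v) := rfl
    have hXk (T) : X (k T) = k (XT T) := rfl
    refine ⟨fun a ha => ?_, fun a b => ?_⟩
    · obtain ⟨S, hS⟩ := k.surjective ⟨a, ha⟩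
      have h : X a = k (XT S) := by rw [← hXk, hS]
      rw [h]; exact (k (XT S)).2
    · obtain ⟨S, rfl⟩ := k.surjective a
      obtain ⟨v, rfl⟩ := e.surjective b
      rw [hiso, ← hXT, ← hiso]
      rfl

end Isotypic

/-! ### Unitary representations and quasikernels -/

section Unitary

variable {G : Type*} [Group G]
  {H : Type*} [NormedAddCommGroup H] [InnerProductSpace ℂ H] [FiniteDimensional ℂ H]

omit [FiniteDimensional ℂ H] in
lemma norm_unitary_apply {σ : Representation ℂ G H}
    (hσ : ∀ (g : G) (x y : H), inner ℂ (σ g x) (σ g y) = inner ℂ x y) (g : G) (x : H) :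
    ‖σ g x‖ = ‖x‖ := by
  have h := hσ g x x
  rw [inner_self_eq_norm_sq_to_K, inner_self_eq_norm_sq_to_K] at h
  have h' : ‖σ g x‖ ^ 2 = ‖x‖ ^ 2 := by exact_mod_cast h
  exact (sq_eq_sq₀ (norm_nonneg _) (norm_nonneg _)).1 h'

omit [FiniteDimensional ℂ H] in
lemma inner_unitary_apply_right {σ : Representation ℂ G H}
    (hσ : ∀ (g : G) (x y : H), inner ℂ (σ g x) (σ g y) = inner ℂ x y) (g : G) (x y : H) :
    inner ℂ x (σ g y) = inner ℂ (σ g⁻¹ x) y := by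
  rw [← hσ g (σ g⁻¹ x), ← Module.End.mul_apply, ← map_mul]; simp

lemma character_inv_eq_conj {σ : Representation ℂ G H}
    (hσ : ∀ (g : G) (x y : H), inner ℂ (σ g x) (σ g y) = inner ℂ x y) (g : G) :
    σ.character g⁻¹ = starRingEnd ℂ (σ.character g) := by
  simp only [character, LinearMap.trace_eq_sum_inner _ (stdOrthonormalBasis ℂ H), map_sum,
    inner_conj_symm]
  refine Finset.sum_congr rfl fun i _ => ?_
  rw [inner_unitary_apply_right hσ, inv_inv]

lemma character_of_eq_smul {V : Type*} [AddCommGroup V] [Module ℂ V] [FiniteDimensional ℂ V]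
    (σ : Representation ℂ G V) (g : G) (c : ℂ) (h : ∀ v, σ g v = c • v) :
    σ.character g = c * finrank ℂ V := by
  have : σ g = c • (1 : V →ₗ[ℂ] V) := by ext v; simpa using h v
  rw [character, this, map_smul, LinearMap.trace_one, smul_eq_mul]

omit [FiniteDimensional ℂ H] in
lemma norm_eq_one_of_eq_smul [Nontrivial H] {σ : Representation ℂ G H}
    (hσ : ∀ (g : G) (x y : H), inner ℂ (σ g x) (σ g y) = inner ℂ x y) (g : G) (c : ℂ)
    (h : ∀ v, σ g v = c • v) : ‖c‖ = 1 := by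
  obtain ⟨v, hv⟩ := exists_ne (0 : H)
  have h1 := norm_unitary_apply hσ g v
  rw [h, norm_smul] at h1
  exact (mul_eq_right₀ (norm_ne_zero_iff.2 hv)).1 h1

/-- A unitary operator acts as a scalar if and only if its trace has maximal modulus. -/
lemma mem_quasikernel_iff [Nontrivial H] {σ : Representation ℂ G H}
    (hσ : ∀ (g : G) (x y : H), inner ℂ (σ g x) (σ g y) = inner ℂ x y) (g : G) :
    g ∈ quasikernel σ.character ↔ ∃ c : ℂ, ∀ v, σ g v = c • v := by
  have hpos : (0 : ℝ) < finrank ℂ H := by exact_mod_cast finrank_pos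
  have hmem : g ∈ quasikernel σ.character ↔ (finrank ℂ H : ℝ) = ‖σ.character g‖ := by
    rw [quasikernel, Set.mem_ofPred_eq, char_one]
    exact_mod_cast Iff.rfl
  rw [hmem]
  constructor
  · intro h
    set t := σ.character g with ht
    set c : ℂ := t / finrank ℂ H with hc
    have hnorm : ‖c‖ = 1 := by
      rw [hc, norm_div, ← h]
      simp [hpos.ne']
    have htc : t = c * finrank ℂ H := by
      rw [hc, div_mul_cancel₀]; exact_mod_cast hpos.ne'
    let b := stdOrthonormalBasis ℂ H
    -- With `c` the normalised trace, of modulus one, these squared distances sum to zero, so `σ g`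
    -- equals `c` on the basis.
    have hterm (i) : ‖σ g (b i) - c • b i‖ ^ 2
        = 2 - 2 * (starRingEnd ℂ c * inner ℂ (b i) (σ g (b i))).re := by
      rw [@norm_sub_sq ℂ, norm_unitary_apply hσ, norm_smul, hnorm, b.norm_eq_one,
        ← inner_conj_symm, inner_smul_left, RCLike.conj_re]
      simp only [RCLike.re_to_complex]
      ring
    have hsum : ∑ i, ‖σ g (b i) - c • b i‖ ^ 2 = 0 := by
      simp only [hterm]
      rw [Finset.sum_sub_distrib, ← Finset.mul_sum, ← Complex.re_sum, ← Finset.mul_sum,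
        ← LinearMap.trace_eq_sum_inner]
      change _ - 2 * (starRingEnd ℂ c * t).re = 0
      rw [htc, ← mul_assoc, ← Complex.normSq_eq_conj_mul_self, Complex.normSq_eq_norm_sq, hnorm]
      simp [mul_comm]
    refine ⟨c, fun v => ?_⟩
    have hb (i) : σ g (b i) = c • b i := by
      have := (Finset.sum_eq_zero_iff_of_nonneg (fun i _ => by positivity)).1 hsum i
        (Finset.mem_univ i)
      exact sub_eq_zero.1 (norm_eq_zero.1 (pow_eq_zero_iff (two_ne_zero)|>.1 this))
    have : σ g = c • (1 : H →ₗ[ℂ] H) := b.toBasis.ext fun i => by simpa using hb i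
    rw [this]; simp
  · rintro ⟨c, hc⟩
    rw [character_of_eq_smul σ g c hc, norm_mul, norm_eq_one_of_eq_smul hσ g c hc]
    simp

end Unitary

/-! ### Error representations: vanishing off the centre and multiplicities -/

section ErrorRep

variable {E : Type*} [Group E] [Finite E]
  {H : Type*} [NormedAddCommGroup H] [InnerProductSpace ℂ H] [FiniteDimensional ℂ H]

/-- The restriction of a representation to a subgroup. -/
abbrev res {E : Type*} [Group E] {H : Type*} [AddCommGroup H] [Module ℂ H]
    (ρ : Representation ℂ E H) (N : Subgroup E) : Representation ℂ N H :=
  ρ.comp N.subtype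

omit [Finite E] in
lemma IsErrorRep.exists_center_eq_smul {ρ : Representation ℂ E H} (hρ : IsErrorRep ρ) {z : E}
    (hz : z ∈ Subgroup.center E) : ∃ c : ℂ, ∀ v, ρ z v = c • v :=
  exists_eq_smul_of_commute ρ hρ.irreducible (ρ z) fun g v => by
    rw [← Module.End.mul_apply, ← Module.End.mul_apply, ← map_mul, ← map_mul,
      Subgroup.mem_center_iff.1 hz g]

/-- The character of an error representation vanishes outside the centre. -/
lemma IsErrorRep.character_eq_zero {ρ : Representation ℂ E H} (hρ : IsErrorRep ρ) {g : E}
    (hg : g ∉ Subgroup.center E) : ρ.character g = 0 := by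
  classical
  have := Fintype.ofFinite E
  have := nontrivial_of_isIrreducible ρ hρ.irreducible
  have h1 : ∑ g : E, ‖ρ.character g‖ ^ 2 = Fintype.card E := by
    have h := sum_character_inv_mul_character ρ hρ.irreducible
    simp only [character_inv_eq_conj hρ.unitary, ← Complex.normSq_eq_conj_mul_self,
      Complex.normSq_eq_norm_sq] at h
    exact_mod_cast h
  -- Each central element contributes the squared degree `|E : Z(E)|`, so the centre already
  -- exhausts the total `|E|`.
  have h2 : ∑ g : E with g ∈ Subgroup.center E, ‖ρ.character g‖ ^ 2 = Fintype.card E := by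
    have hz : ∀ g ∈ Finset.univ.filter (fun g : E => g ∈ Subgroup.center E),
        ‖ρ.character g‖ ^ 2 = ((Subgroup.center E).index : ℝ) := by
      intro g hg
      obtain ⟨c, hc⟩ := hρ.exists_center_eq_smul (Finset.mem_filter.1 hg).2
      rw [character_of_eq_smul ρ g c hc, norm_mul, norm_eq_one_of_eq_smul hρ.unitary g c hc, one_mul,
        Complex.norm_natCast, hρ.degree, Real.sq_sqrt (Nat.cast_nonneg _)]
    rw [Finset.sum_congr rfl hz, Finset.sum_const, nsmul_eq_mul, ← Fintype.card_subtype,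
      ← Nat.card_eq_fintype_card, ← Nat.card_eq_fintype_card,
      ← (Subgroup.center E).card_mul_index]
    push_cast; rfl
  have h3 : ∑ g : E with g ∉ Subgroup.center E, ‖ρ.character g‖ ^ 2 = 0 := by
    have := Finset.sum_filter_add_sum_filter_not Finset.univ (fun g : E => g ∈ Subgroup.center E)
      (fun g => ‖ρ.character g‖ ^ 2)
    linarith
  have h4 := (Finset.sum_eq_zero_iff_of_nonneg (fun i _ => by positivity)).1 h3 g (by simpa using hg)
  simpa using h4

omit [Finite E] in
lemma finrank_intertwiningMap_eq_charProd {ρ : Representation ℂ E H} {N : Subgroup E} [Fintype N]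
    {V : Type*} [AddCommGroup V] [Module ℂ V] [FiniteDimensional ℂ V] (τ : Representation ℂ N V) :
    (finrank ℂ (IntertwiningMap τ (res ρ N)) : ℂ) =
      charProd τ.character (fun n : N => ρ.character n) := by
  have : Invertible (Nat.card N : ℂ) := invertibleOfNonzero (by simp)
  rw [← card_inv_mul_sum_char_mul_char_eq_finrank, charProd, Nat.card_eq_fintype_card]
  congr 1
  refine Fintype.sum_equiv (Equiv.inv N) _ _ fun g => ?_
  simp [mul_comm, character]

/-- In the multiplicity formula only `Z(E) ∩ N` survives. There the scalars of `ρ g` and `τ g⁻¹`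
cancel, leaving the product of the two degrees for each element. -/
lemma IsErrorRep.finrank_intertwiningMap {ρ : Representation ℂ E H} (hρ : IsErrorRep ρ)
    {N : Subgroup E} [Fintype N]
    {V : Type*} [AddCommGroup V] [Module ℂ V] [FiniteDimensional ℂ V] (τ : Representation ℂ N V)
    (hτ : τ.IsIrreducible) (hne : ∃ T : IntertwiningMap τ (res ρ N), T ≠ 0) :
    (finrank ℂ (IntertwiningMap τ (res ρ N)) : ℂ) =
      (Nat.card (Subgroup.center E ⊓ N : Subgroup E) : ℂ) *
        (Real.sqrt ((Subgroup.center E).index : ℝ) : ℂ) * τ.character 1 / (Nat.card N : ℂ) := by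
  classical
  have := hτ
  have : Invertible (Nat.card N : ℂ) := invertibleOfNonzero (by simp)
  obtain ⟨T, hT⟩ := hne
  have hinj : Function.Injective T := (IsIrreducible.injective_or_eq_zero T).resolve_right hT
  have hterm (g : N) : (res ρ N).character g * τ.character g⁻¹ =
      if (g : E) ∈ Subgroup.center E then (finrank ℂ H : ℂ) * finrank ℂ V else 0 := by
    change ρ.character g * _ = _
    split_ifs with hg
    · obtain ⟨c, hc⟩ := hρ.exists_center_eq_smul hg
      obtain ⟨c', hc'⟩ := hρ.exists_center_eq_smul (inv_mem hg)
      have := nontrivial_of_isIrreducible ρ hρ.irreducible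
      have hcc : c * c' = 1 := by
        obtain ⟨v, hv⟩ := exists_ne (0 : H)
        have h : (ρ g * ρ (g : E)⁻¹) v = v := by rw [← map_mul]; simp
        rw [Module.End.mul_apply, hc', map_smul, hc, smul_smul, mul_comm c'] at h
        exact smul_left_injective ℂ hv (h.trans (one_smul ℂ v).symm)
      -- The injective intertwiner `T` transports the central scalar from `ρ` to `τ`.
      have hτc (v) : τ g⁻¹ v = c' • v := by
        apply hinj
        rw [IntertwiningMap.isIntertwining, map_smul, ← hc']
        rfl
      rw [character_of_eq_smul ρ g c hc, character_of_eq_smul τ g⁻¹ c' hτc,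
        mul_mul_mul_comm, hcc, one_mul]
    · rw [hρ.character_eq_zero hg, zero_mul]
  have hcard : (Finset.univ.filter fun g : N => (g : E) ∈ Subgroup.center E).card =
      Nat.card (Subgroup.center E ⊓ N : Subgroup E) := by
    rw [← Fintype.card_subtype, ← Nat.card_eq_fintype_card]
    exact Nat.card_congr
      { toFun := fun g => ⟨g.1, g.2, g.1.2⟩
        invFun := fun g => ⟨⟨g.1, g.2.2⟩, g.2.1⟩
        left_inv := fun _ => rfl
        right_inv := fun _ => rfl }
  rw [← card_inv_mul_sum_char_mul_char_eq_finrank, Finset.sum_congr rfl fun g _ => hterm g,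
    ← Finset.sum_filter, Finset.sum_const, hcard, nsmul_eq_mul, ← hρ.degree, char_one,
    Complex.ofReal_natCast, div_eq_inv_mul]
  ring

end ErrorRep

/-! ### The character projector is the orthogonal projector -/

section Projection

variable {G : Type*} [Group G] [Fintype G]
  {V : Type*} [AddCommGroup V] [Module ℂ V] [FiniteDimensional ℂ V]
  {H : Type*} [NormedAddCommGroup H] [InnerProductSpace ℂ H] [FiniteDimensional ℂ H]

omit [FiniteDimensional ℂ H] in
lemma isoProj_apply_of_mem_range (σ : Representation ℂ G H)
    (τ : Representation ℂ G V) (hτ : τ.IsIrreducible) (x : H)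
    (hx : x ∈ LinearMap.range (isoProj σ τ.character)) : isoProj σ τ.character x = x := by
  have h := range_isoProj_le σ τ (LinearMap.ker (isoProj σ τ.character - 1)) (fun T v => by
    simp [isoProj_intertwiningMap_apply σ τ hτ]) hx
  simpa [sub_eq_zero] using h

omit [FiniteDimensional ℂ V] [FiniteDimensional ℂ H] in
lemma isoProj_apply_comm (σ : Representation ℂ G H) (τ : Representation ℂ G V) (h : G) (x : H) :
    isoProj σ τ.character (σ h x) = σ h (isoProj σ τ.character x) := by
  rw [isoProj_apply, isoProj_apply, map_smul, map_sum]
  congr 1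
  refine Fintype.sum_equiv (MulAut.conj h⁻¹).toEquiv _ _ (fun g => ?_)
  have : τ.character (h⁻¹ * g * h)⁻¹ = τ.character g⁻¹ := by
    simpa [mul_assoc] using τ.char_conj g⁻¹ h⁻¹
  simp only [MulEquiv.toEquiv_eq_coe, MulEquiv.coe_toEquiv, MulAut.conj_apply, inv_inv, this,
    map_smul]
  simp only [← Module.End.mul_apply, ← map_mul]
  simp [mul_assoc]

lemma starProjection_range_isoProj (σ : Representation ℂ G H)
    (hσ : ∀ (g : G) (x y : H), inner ℂ (σ g x) (σ g y) = inner ℂ x y)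
    (τ : Representation ℂ G V) (hτ : τ.IsIrreducible) (x : H) :
    (LinearMap.range (isoProj σ τ.character)).starProjection x = isoProj σ τ.character x := by
  set C := LinearMap.range (isoProj σ τ.character) with hC
  -- `C`, and so `Cᗮ`, is invariant under the unitary action; hence the projected vector lies in
  -- both and is orthogonal to itself.
  have horth (y : H) (hy : y ∈ Cᗮ) : isoProj σ τ.character y = 0 := by
    rw [← inner_self_eq_zero (𝕜 := ℂ)]
    nth_rw 2 [isoProj_apply]
    rw [inner_smul_right, inner_sum, Finset.sum_eq_zero, mul_zero]
    intro g _
    rw [inner_smul_right, inner_unitary_apply_right hσ, ← isoProj_apply_comm,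
      Submodule.inner_right_of_mem_orthogonal
        (LinearMap.mem_range_self (isoProj σ τ.character) _ : _ ∈ C) hy, mul_zero]
  have h1 := horth _ (C.sub_starProjection_mem_orthogonal x)
  rw [map_sub, sub_eq_zero] at h1
  rw [h1, isoProj_apply_of_mem_range σ τ hτ]
  exact C.starProjection_apply_mem x

end Projection

/-- Errors outside the inertia group map the isotypic component into its orthogonal complement. -/
lemma isoProj_apply_eq_zero_of_notMem_inertiaGroup {E : Type*} [Group E]
    {H : Type*} [NormedAddCommGroup H] [InnerProductSpace ℂ H]
    {V : Type*} [AddCommGroup V] [Module ℂ V] [FiniteDimensional ℂ V]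
    (ρ : Representation ℂ E H) (N : Subgroup E) [N.Normal] [Fintype N]
    (τ : Representation ℂ N V) (hτ : τ.IsIrreducible) (e : E)
    (he : e ∉ inertiaGroup N τ.character) (x : H)
    (hx : x ∈ LinearMap.range (isoProj (res ρ N) τ.character)) :
    isoProj (res ρ N) τ.character (ρ e x) = 0 := by
  have hα : ∃ g, τ.character (MulAut.conjNormal e g) ≠ τ.character g := by
    by_contra! h
    exact he h
  refine range_isoProj_le (res ρ N) τ (LinearMap.ker (isoProj (res ρ N) τ.character ∘ₗ ρ e))
    (fun T v => ?_) hx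
  rw [LinearMap.mem_ker, LinearMap.comp_apply, isoProj_apply]
  have h : ∑ g : N, τ.character g⁻¹ • res ρ N g (ρ e (T v)) = ρ e (T
      (∑ g : N, τ.character (MulAut.conjNormal e g)⁻¹ • τ g v)) := by
    rw [map_sum, map_sum]
    symm
    refine Fintype.sum_equiv (MulAut.conjNormal e).toEquiv _ _ (fun g => ?_)
    rw [map_smul, map_smul, IntertwiningMap.isIntertwining]
    change _ • (ρ e * ρ g) (T v) = _ • (ρ (MulAut.conjNormal e g : N) * ρ e) (T v)
    rw [← map_mul, ← map_mul, MulAut.conjNormal_apply, inv_mul_cancel_right]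
    rfl
  rw [h, sum_character_twist_smul_apply τ hτ _ hα, map_zero, map_zero, smul_zero]

lemma inner_isometryEquiv_tmul {A B C : Type*} [NormedAddCommGroup A] [InnerProductSpace ℂ A]
    [NormedAddCommGroup B] [InnerProductSpace ℂ B] [NormedAddCommGroup C] [InnerProductSpace ℂ C]
    (f : (A ⊗[ℂ] B) ≃ₗᵢ[ℂ] C) (a a' : A) (b b' : B) :
    inner ℂ (f (a ⊗ₜ b)) (f (a' ⊗ₜ b')) = inner ℂ a a' * inner ℂ b b' := by
  rw [f.inner_map_map, TensorProduct.inner_tmul]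

end CliffordCode

end

/-! ### The main theorem -/

open CliffordCode Representation Module TensorProduct in
theorem theorem1 {E : Type*} [Group E] [Finite E]
    {H : Type*} [NormedAddCommGroup H] [InnerProductSpace ℂ H] [FiniteDimensional ℂ H]
    (ρ : Representation ℂ E H) (N : Subgroup E) [N.Normal] [Fintype N] (χ : N → ℂ)
    (hdata : CliffordCode.IsData ρ N χ)
    (L : Subgroup E)
    (hLN : (CliffordCode.inertiaGroup N χ : Set E) = (L : Set E) * (N : Set E))
    (hcomm : ⁅L, N⁆ = ⊥) :
    ∃ (D : CliffordCode.Subsystem (CliffordCode.code ρ N χ)) (σ : Representation ℂ L D.A),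
      -- `A` is an irreducible `ℂL`-module, and `L` acts on `C = A ⊗ B` through `A`
      σ.IsIrreducible ∧
      (∀ (l : L) (a : D.A) (b : D.B),
        ρ (l : E) (D.iso (a ⊗ₜ[ℂ] b) : H) = (D.iso (σ l a ⊗ₜ[ℂ] b) : H)) ∧
      -- the dimensions of `A` and `B`
      (Module.finrank ℂ D.A : ℂ) =
        (Nat.card (Subgroup.center E ⊓ N : Subgroup E) : ℂ) *
          (Real.sqrt ((Subgroup.center E).index : ℝ) : ℂ) * χ 1 / (Nat.card N : ℂ) ∧
      (Module.finrank ℂ D.B : ℂ) = χ 1 ∧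
      -- the detectable errors
      ∀ e : E, D.Detects (ρ e) ↔
        e ∈ (Set.univ : Set E) \ ((CliffordCode.inertiaGroup N χ : Set E) \
          ((Subtype.val '' CliffordCode.quasikernel σ.character : Set E) * (N : Set E))) := by
  obtain ⟨hρ, -, ⟨n, τ, hτ, rfl⟩, hpos⟩ := hdata
  have hU : ∀ (g : N) (x y : H), inner ℂ (res ρ N g x) (res ρ N g y) = inner ℂ x y :=
    fun g => hρ.unitary g
  have hne : ∃ T : IntertwiningMap τ (res ρ N), T ≠ 0 := by
    by_contra! h
    have : Subsingleton (IntertwiningMap τ (res ρ N)) := ⟨fun a b => (h a).trans (h b).symm⟩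
    rw [← finrank_intertwiningMap_eq_charProd, finrank_zero_of_subsingleton] at hpos
    simp at hpos
  obtain ⟨A, B, iso, e, hA, hNact, hact⟩ := exists_tensor_decomposition (res ρ N) hU τ hτ hne
  have hVnt := nontrivial_of_isIrreducible τ hτ
  have hBnt : Nontrivial B := e.symm.toEquiv.nontrivial
  have hAnt : Nontrivial A := by
    apply Module.nontrivial_of_finrank_pos (R := ℂ)
    rw [hA, Nat.pos_iff_ne_zero]
    intro h
    rw [← finrank_intertwiningMap_eq_charProd, h] at hpos
    simp at hpos
  have hLNc (l : L) (g : N) : (l : E) * g = g * l :=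
    Subgroup.commutator_eq_bot_iff_le_centralizer.1 hcomm l.2 g g.2 |>.symm
  have hL (l : L) := hact (ρ l) (fun g x => by
    change (ρ l * ρ g) x = (ρ g * ρ l) x
    rw [← map_mul, ← map_mul, hLNc])
  let SA : Subrepresentation (res ρ L) := ⟨A, fun l a ha => (hL l).1 a ha⟩
  let σ : Representation ℂ L A := SA.toRepresentation
  have hσ (l : L) (a : A) (b : B) : ρ l (iso (a ⊗ₜ[ℂ] b) : H) = iso (σ l a ⊗ₜ[ℂ] b) :=
    (hL l).2 a b
  have hproj (x : H) : (code ρ N τ.character).starProjection x = isoProj (res ρ N) τ.character x :=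
    starProjection_range_isoProj (res ρ N) hU τ hτ x
  have hmem (x : A ⊗[ℂ] B) : (iso x : H) ∈ LinearMap.range (isoProj (res ρ N) τ.character) :=
    (iso x).2
  have hfix (x : A ⊗[ℂ] B) : isoProj (res ρ N) τ.character (iso x : H) = iso x :=
    isoProj_apply_of_mem_range (res ρ N) τ hτ _ (hmem x)
  have hzero (g : E) (hg : g ∉ inertiaGroup N τ.character) (x : A ⊗[ℂ] B) :
      isoProj (res ρ N) τ.character (ρ g (iso x : H)) = 0 :=
    isoProj_apply_eq_zero_of_notMem_inertiaGroup ρ N τ hτ g hg _ (hmem x)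
  have hmul (l : L) (g : N) (a : A) (v) : ρ ((l : E) * g) (iso (a ⊗ₜ[ℂ] e v) : H) =
      iso (σ l a ⊗ₜ[ℂ] e (τ g v)) := by
    rw [map_mul, Module.End.mul_apply, ← hσ, ← hNact]
    rfl
  let D : Subsystem (code ρ N τ.character) := { A := A, B := B, iso := iso }
  refine ⟨D, σ, ?_, hσ, ?_, ?_, ?_⟩
  · have : Nontrivial (Subrepresentation σ) := ⟨⊥, ⊤, fun h =>
      bot_ne_top (α := Submodule ℂ A) (congrArg Subrepresentation.toSubmodule h)⟩
    refine ⟨fun S => ?_⟩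
    by_cases hS : S.toSubmodule = ⊥
    · exact Or.inl (Subrepresentation.toSubmodule_injective hS)
    right
    apply Subrepresentation.toSubmodule_injective
    change S.toSubmodule = ⊤
    rw [← Submodule.orthogonal_eq_bot_iff, Submodule.eq_bot_iff]
    intro a ha
    -- `M` is the `E`-submodule generated by `S ⊗ B`; it is all of `H` once `S ≠ 0`.
    let M : Subrepresentation ρ :=
      ⟨Submodule.span ℂ {x | ∃ (g : E), ∃ s ∈ S.toSubmodule, ∃ b : B,
        x = ρ g (iso (s ⊗ₜ[ℂ] b) : H)}, fun g x hx => by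
        induction hx using Submodule.span_induction with
        | mem x hx =>
          obtain ⟨h, s, hs, b, rfl⟩ := hx
          exact Submodule.subset_span ⟨g * h, s, hs, b, by rw [map_mul]; rfl⟩
        | zero => simp
        | add x y _ _ hx hy => rw [map_add]; exact add_mem hx hy
        | smul c x _ hx => rw [map_smul]; exact Submodule.smul_mem _ c hx⟩
    obtain ⟨b, hb⟩ := exists_ne (0 : B)
    have iso_ne (a : A) (ha : a ≠ 0) : (iso (a ⊗ₜ[ℂ] b) : H) ≠ 0 := by
      rw [← norm_ne_zero_iff, Submodule.norm_coe, iso.norm_map, norm_tmul]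
      exact mul_ne_zero (norm_ne_zero_iff.2 ha) (norm_ne_zero_iff.2 hb)
    have hM : M = ⊤ := by
      have := hρ.irreducible
      refine (eq_bot_or_eq_top M).resolve_left fun h => ?_
      obtain ⟨s, hs, hs0⟩ := Submodule.exists_mem_ne_zero_of_ne_bot hS
      have h1 : (iso (s ⊗ₜ[ℂ] b) : H) ∈ M.toSubmodule :=
        Submodule.subset_span ⟨1, s, hs, b, by simp⟩
      rw [h] at h1
      exact iso_ne s hs0 h1
    -- The inertia group preserves `S ⊗ B` and other errors project to zero, so `M` projects into `S
    -- ⊗ B`. Since `M = H`, a vector `a ⊗ b` with `a ⊥ S` is orthogonal to itself.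
    have hPM (x : H) (hx : x ∈ M.toSubmodule) :
        inner ℂ (iso (a ⊗ₜ[ℂ] b) : H) (isoProj (res ρ N) τ.character x) = 0 := by
      induction hx using Submodule.span_induction with
      | mem x hx =>
        obtain ⟨h, s, hs, b', rfl⟩ := hx
        by_cases hh : h ∈ inertiaGroup N τ.character
        · obtain ⟨l, hl, g, hg, rfl⟩ := Set.mem_mul.1 (hLN ▸ hh : h ∈ (L : Set E) * (N : Set E))
          obtain ⟨v, rfl⟩ := e.surjective b'
          rw [hmul ⟨l, hl⟩ ⟨g, hg⟩, hfix, ← Submodule.coe_inner, inner_isometryEquiv_tmul,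
            Submodule.inner_left_of_mem_orthogonal (S.apply_mem_toSubmodule _ hs) ha, zero_mul]
        · rw [hzero _ hh, inner_zero_right]
      | zero => simp
      | add x y _ _ hx hy => rw [map_add, inner_add_right, hx, hy, add_zero]
      | smul c x _ hx => rw [map_smul, inner_smul_right, hx, mul_zero]
    by_contra ha0
    have h1 := hPM (iso (a ⊗ₜ[ℂ] b)) (hM ▸ Submodule.mem_top)
    rw [hfix, inner_self_eq_zero] at h1
    exact iso_ne a ha0 h1
  · rw [← hρ.finrank_intertwiningMap τ hτ hne, ← hA]
  · rw [char_one, e.finrank_eq]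
  · have hUσ (l : L) (x y : A) : inner ℂ (σ l x) (σ l y) = inner ℂ x y := hρ.unitary l x y
    intro g
    simp only [Set.mem_sdiff, Set.mem_univ, true_and, not_and, not_not]
    constructor
    · rintro ⟨T, hT⟩ hg
      rw [hLN] at hg
      obtain ⟨l, hl, m, hm, rfl⟩ := Set.mem_mul.1 hg
      refine Set.mul_mem_mul ⟨⟨l, hl⟩, (mem_quasikernel_iff hUσ _).2 ?_, rfl⟩ hm
      obtain ⟨b, hb⟩ := exists_ne (0 : B)
      -- This choice of `v` makes `m` carry `e v` to `b`, so detectability reads `σ l a ⊗ b = a ⊗ T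
      -- (e v)`; contracting the second factor with `b` shows that `σ l` is a scalar.
      let v := τ (⟨m, hm⟩ : N)⁻¹ (e.symm b)
      have hv : e (τ ⟨m, hm⟩ v) = b := by
        rw [← Module.End.mul_apply, ← map_mul]; simp
      let f : A ⊗[ℂ] B →ₗ[ℂ] A :=
        (TensorProduct.rid ℂ A).toLinearMap ∘ₗ LinearMap.lTensor A (innerₛₗ ℂ b)
      have hf (a : A) (b' : B) : f (a ⊗ₜ b') = (inner ℂ b b' : ℂ) • a := by simp [f]
      have hbb : (inner ℂ b b : ℂ) ≠ 0 := inner_self_ne_zero.2 hb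
      refine ⟨(inner ℂ b b : ℂ)⁻¹ * inner ℂ b (T (e v)), fun a => ?_⟩
      have h1 : (code ρ N τ.character).starProjection (ρ (l * m) (iso (a ⊗ₜ[ℂ] e v) : H)) =
        iso (a ⊗ₜ[ℂ] T (e v)) := hT a (e v)
      rw [hproj, hmul ⟨l, hl⟩ ⟨m, hm⟩, hfix, hv] at h1
      have h2 := congrArg f (iso.injective (Subtype.ext h1))
      rw [hf, hf] at h2
      rw [mul_smul, ← h2, smul_smul, inv_mul_cancel₀ hbb, one_smul]
    · intro h
      by_cases hg : g ∈ inertiaGroup N τ.character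
      · obtain ⟨_, ⟨l, hl, rfl⟩, m, hm, rfl⟩ := Set.mem_mul.1 (h hg)
        obtain ⟨c, hc⟩ := (mem_quasikernel_iff hUσ _).1 hl
        -- The scalar by which `l` acts on `A` is absorbed into the action of `m` on `B`.
        refine ⟨c • (e.toLinearMap ∘ₗ τ ⟨m, hm⟩ ∘ₗ e.symm.toLinearMap), fun a b => ?_⟩
        obtain ⟨v, rfl⟩ := e.surjective b
        change (code ρ N τ.character).starProjection (ρ (l * m) (iso (a ⊗ₜ[ℂ] e v) : H)) =
          iso (a ⊗ₜ[ℂ] (c • e (τ ⟨m, hm⟩ (e.symm (e v)))))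
        rw [hproj, hmul l ⟨m, hm⟩, hfix, hc, smul_tmul, e.symm_apply_apply]
      · refine ⟨0, fun a b => ?_⟩
        change (code ρ N τ.character).starProjection (ρ g (iso (a ⊗ₜ[ℂ] b) : H)) =
          iso (a ⊗ₜ[ℂ] (0 : B))
        rw [hproj, hzero g hg, tmul_zero, iso.map_zero]
        rfl
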